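/- Let $k\ge 1$. The infinite $k$-star $\operatorname{instar}(k)$ consists of a center $v_{1,0}=\dots=v_{k,0}$ and $k$ ordered branches, branch $i\in\{1,\dots,k\}$ having vertices $v_{i,1},v_{i,2},\dots$, with $v_{i,j}$ adjacent to $v_{i,j+1}$ for all $i$ and all $j\ge 0$. Chips labeled $1,\dots,N$ are placed on the vertices; $\mathcal C(v)$ denotes the set of labels of the chips on $v$ in the configuration $\mathcal C$. Firing the center means choosing $k$ chips $n_1<\dots<n_k$ on it and moving chip $n_i$ to $v_{i,1}$ for each $i$; firing $v_{i,j}$ with $j\ge 1$ means choosing two chips $a<b$ on it and moving $a$ to $v_{i,j-1}$ and $b$ to $v_{i,j+1}$. A configuration is stable if every vertex $v$ carries fewer than $\deg(v)$ chips. Let $\Delta^{k,2}$ be the configuration with the chips $1,\dots,2k$ all on the center, and let $\mathcal T^{k,2}$ be the set of stable configurations reachable from $\Delta^{k,2}$ by finitely many fires. A standard Young tableau of shape $(2)^k$ is a filling $Y=(y_{i,j})_{1\le i\le k,\ 1\le j\le 2}$ that uses each of the numbers $1,\dots,2k$ exactly once and is strictly increasing along rows (in $j$) and down columns (in $i$).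 Theorem. There is a bijection $\varphi$ from $\mathcal T^{k,2}$ to the set of standard Young tableaux of shape $(2)^k$ such that, for every $\mathcal C\in\mathcal T^{k,2}$, the tableau $\varphi(\mathcal C)=(y_{i,j})$ satisfies $\mathcal C(v_{i,j})=\{y_{i,j}\}$ for all $1\le i\le k$ and $1\le j\le 2$. Its inverse sends a standard Young tableau $Y=(y_{i,j})$ to the configuration $\mathcal C$ with $\mathcal C(v_{i,j})=\{y_{i,j}\}$ for $1\le i\le k$, $1\le j\le 2$, and $\mathcal C(v)=\emptyset$ for every other vertex $v$. Hence both the standard Young tableaux of shape $(2)^k$ and the configurations in $\mathcal T^{k,2}$ are counted by the Catalan number: $|\mathcal T^{k,2}|=C_k=\frac{1}{k+1}\binom{2k}{k}$. -/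

import Mathlib

namespace StarChip

/-! ### The infinite `k`-star -/

/-- Vertices of the infinite `k`-star: the center, and on each of the `k` branches the vertices
`branch i j` at distance `j + 1` from the center. Branches are indexed by `Fin k`, in order. -/
inductive Vertex (k : ℕ) : Type
  | center : Vertex k
  | branch (i : Fin k) (j : ℕ) : Vertex k

/-- `vert i j` is the vertex of level `j` on branch `i`; for `j = 0` it is the center, whatever
the branch `i`. -/
def vert {k : ℕ} (i : Fin k) : ℕ → Vertex k
  | 0 => Vertex.center
  | j + 1 => Vertex.branch i j

/-- The infinite `k`-star graph: on every branch, consecutive levels are joined by an edge. -/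
def instar (k : ℕ) : SimpleGraph (Vertex k) :=
  SimpleGraph.fromRel fun u w => ∃ (i : Fin k) (j : ℕ), u = vert i j ∧ w = vert i (j + 1)

/-- The degree of a vertex: its number of neighbors in the infinite `k`-star. -/
noncomputable def deg {k : ℕ} (v : Vertex k) : ℕ := ((instar k).neighborSet v).ncard

theorem vert_succ_inj {k : ℕ} {i i' : Fin k} {j j' : ℕ} (h : vert i (j + 1) = vert i' (j' + 1)) :
    i = i' ∧ j = j' := by
  simpa [vert] using h

theorem deg_center (k : ℕ) : deg (Vertex.center : Vertex k) = k := by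
  have h : (instar k).neighborSet Vertex.center = Set.range fun i : Fin k => vert i 1 := by
    ext w
    simp only [instar, SimpleGraph.mem_neighborSet, SimpleGraph.fromRel_adj, Set.mem_range]
    constructor
    · rintro ⟨_, ⟨i, j, h1, h2⟩ | ⟨i, j, _, h2⟩⟩
      · cases j with
        | zero => exact ⟨i, h2.symm⟩
        | succ j => simp [vert] at h1
      · simp [vert] at h2
    · rintro ⟨i, rfl⟩
      exact ⟨by simp [vert], Or.inl ⟨i, 0, rfl, rfl⟩⟩
  have hinj : Function.Injective fun i : Fin k => vert i 1 := fun _ _ e => (vert_succ_inj e).1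
  rw [deg, h, ← Set.image_univ, Set.ncard_image_of_injective _ hinj, Set.ncard_univ,
    Nat.card_eq_fintype_card, Fintype.card_fin]

theorem deg_branch {k : ℕ} (i : Fin k) (j : ℕ) : deg (vert i (j + 1)) = 2 := by
  have h : (instar k).neighborSet (vert i (j + 1)) = {vert i j, vert i (j + 2)} := by
    ext w
    simp only [instar, SimpleGraph.mem_neighborSet, SimpleGraph.fromRel_adj, Set.mem_insert_iff,
      Set.mem_singleton_iff]
    constructor
    · rintro ⟨_, ⟨i', j', h1, h2⟩ | ⟨i', j', h1, h2⟩⟩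
      · cases j' with
        | zero => simp [vert] at h1
        | succ j' =>
          obtain ⟨rfl, rfl⟩ := vert_succ_inj h1
          exact Or.inr h2
      · obtain ⟨rfl, rfl⟩ := vert_succ_inj h2
        exact Or.inl h1
    · rintro (rfl | rfl)
      · exact ⟨by cases j <;> simp [vert], Or.inr ⟨i, j, rfl, rfl⟩⟩
      · exact ⟨by simp [vert], Or.inl ⟨i, j + 1, rfl, rfl⟩⟩
  rw [deg, h, Set.ncard_pair]
  cases j <;> simp [vert]

/-! ### Labeled chip-firing -/

/-- The chips, labeled by the numbers `1, …, N`. -/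
abbrev Chip (N : ℕ) : Type := Set.Icc 1 N

/-- A labeled chip configuration with chips `1, …, N`: every chip sits on one vertex. -/
abbrev Config (k N : ℕ) : Type := Chip N → Vertex k

/-- The set of labels of the chips that sit on the vertex `v`. -/
def chipsAt {k N : ℕ} (C : Config k N) (v : Vertex k) : Set ℕ :=
  {n : ℕ | ∃ h : n ∈ Set.Icc 1 N, C ⟨n, h⟩ = v}

/-- `Fire C C'`: the configuration `C'` arises from `C` by firing one vertex once.

* Firing the center: `k` chips `n 1 < ⋯ < n k` on the center are chosen, and chip `n i` moves to
  level `1` of branch `i`.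
* Firing the vertex of level `j + 1` on branch `i`: two chips `a < b` on it are chosen, chip `a`
  moves to level `j` and chip `b` moves to level `j + 2` of branch `i`.

All chips which are not chosen stay where they are. -/
inductive Fire {k N : ℕ} : Config k N → Config k N → Prop
  | center (C C' : Config k N) (n : Fin k → Chip N) (hn : StrictMono n)
      (hC : ∀ i, C (n i) = Vertex.center)
      (hmove : ∀ i, C' (n i) = vert i 1)
      (hstay : ∀ c, (∀ i, c ≠ n i) → C' c = C c) : Fire C C'
  | branch (C C' : Config k N) (i : Fin k) (j : ℕ) (a b : Chip N) (hab : a < b)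
      (ha : C a = vert i (j + 1)) (hb : C b = vert i (j + 1))
      (hmovea : C' a = vert i j) (hmoveb : C' b = vert i (j + 2))
      (hstay : ∀ c, c ≠ a → c ≠ b → C' c = C c) : Fire C C'

/-- `C'` is reachable from `C` by a finite sequence of fires. -/
def Reachable {k N : ℕ} (C C' : Config k N) : Prop := Relation.ReflTransGen Fire C C'

/-- A configuration is stable if every vertex holds fewer chips than its degree. -/
def Stable {k N : ℕ} (C : Config k N) : Prop := ∀ v : Vertex k, (chipsAt C v).ncard < deg v

/-- The starting configuration `Δ^{k,m}`: the chips `1, …, k m` all sit on the center. -/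
def start (k m : ℕ) : Config k (k * m) := fun _ => Vertex.center

/-- The set `𝒯^{k,m}` of the stable configurations reachable from `Δ^{k,m}`. -/
def stableConfigs (k m : ℕ) : Set (Config k (k * m)) :=
  {C | Reachable (start k m) C ∧ Stable C}

/-! ### Standard Young tableaux -/

/-- A standard Young tableau of shape `μ`: a filling of the cells of `μ` in which each of the
numbers `1, …, |μ|` is used exactly once, and whose rows and columns are strictly increasing.
Rows and columns are numbered from `0`; the entries outside `μ` are set to `0`, so that equal
fillings are equal tableaux. -/
@[ext]
structure StandardYoungTableau (μ : YoungDiagram) where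
  entry : ℕ → ℕ → ℕ
  bijOn : Set.BijOn (fun c : ℕ × ℕ => entry c.1 c.2) (μ.cells : Set (ℕ × ℕ)) (Set.Icc 1 μ.card)
  row_strict : ∀ {i j₁ j₂ : ℕ}, j₁ < j₂ → (i, j₂) ∈ μ → entry i j₁ < entry i j₂
  col_strict : ∀ {i₁ i₂ j : ℕ}, i₁ < i₂ → (i₂, j) ∈ μ → entry i₁ j < entry i₂ j
  zeros : ∀ {i j : ℕ}, (i, j) ∉ μ → entry i j = 0

/-- The rectangular Young diagram `(m)^k = (m, …, m)` with `k` rows of length `m`. -/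
def rect (k m : ℕ) : YoungDiagram :=
  YoungDiagram.ofRowLens (List.replicate k m) (List.sortedGE_iff_pairwise.2 (by simp [List.pairwise_replicate]))

theorem mem_rect {k m i j : ℕ} : (i, j) ∈ rect k m ↔ i < k ∧ j < m := by
  simp [rect, YoungDiagram.mem_ofRowLens]

end StarChip

/-!
From `2k` chips on the center, the moves are forced up to order, and only the labels leave a choice.
The center first fires some `s 1 < ⋯ < s k` and then, since no branch can fire yet, the remaining
chips `n 1 < ⋯ < n k`; now branch `i` holds `s i` and `n i` on level `1`, and taking minima and
maxima row by row yields a filling of the `k × 2` rectangle whose rows and columns increase. Next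
every branch fires once, and finally the center, which by then holds exactly the first column, fires
it. So the branches of the stable configuration read off the rows of the filling. Every standard
filling arises, by firing its first and then its second column.

For the count, record for `n = 1, …, 2k` the column containing `n`. The columns are recovered from
this word as its increasing position lists, and the rows increase if and only if no prefix contains
more second-column letters than first-column letters, that is, the word is a Dyck word.
-/

namespace StarChip

theorem eq_of_strictMono_of_range_subset {ι α : Type*} [LinearOrder ι] [Finite ι] [Preorder α]
    {f g : ι → α} (hf : StrictMono f) (hg : StrictMono g) (h : Set.range f ⊆ Set.range g) :
    f = g := by
  refine (hf.range_inj hg).1 (Set.eq_of_subset_of_ncard_le h ?_)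
  rw [Set.ncard_range_of_injective hf.injective, Set.ncard_range_of_injective hg.injective]

theorem strictMono_column {α β γ : Type*} [Preorder α] [Preorder β] [Preorder γ]
    {f : α × β → γ} (hf : StrictMono f) (b : β) : StrictMono fun a => f (a, b) :=
  fun _ _ h => hf (Prod.mk_lt_mk_iff_left.2 h)

theorem strictMono_row {α β γ : Type*} [Preorder α] [Preorder β] [Preorder γ]
    {f : α × β → γ} (hf : StrictMono f) (a : α) : StrictMono fun b => f (a, b) :=
  fun _ _ h => hf (Prod.mk_lt_mk_iff_right.2 h)

theorem strictMono_prod_of_strictMono {α β γ : Type*} [PartialOrder α] [PartialOrder β]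
    [Preorder γ] {f : α × β → γ} (hl : ∀ b, StrictMono fun a => f (a, b))
    (hr : ∀ a, StrictMono fun b => f (a, b)) : StrictMono f := by
  rintro ⟨a, b⟩ ⟨a', b'⟩ hlt
  obtain ⟨ha, hb⟩ | ⟨ha, hb⟩ := Prod.mk_lt_mk.1 hlt
  · exact (hl b ha).trans_le ((hr a').monotone hb)
  · exact ((hl b).monotone ha).trans_lt (hr a' hb)

theorem eq_extend_iff {ι α β : Type*} {f : ι → α} (hf : Function.Injective f) {g : ι → β}
    {e h : α → β} :
    h = Function.extend f g e ↔ (∀ i, h (f i) = g i) ∧ ∀ a, (∀ i, a ≠ f i) → h a = e a := by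
  constructor
  · rintro rfl
    exact ⟨hf.extend_apply _ _,
      fun a ha => Function.extend_apply' _ _ _ fun ⟨i, hi⟩ => ha i hi.symm⟩
  · rintro ⟨hg, he⟩
    funext a
    by_cases ha : ∃ i, f i = a
    · obtain ⟨i, rfl⟩ := ha
      rw [hg, hf.extend_apply]
    · rw [Function.extend_apply' _ _ _ ha, he a fun i hi => ha ⟨i, hi.symm⟩]

theorem le_ncard_iff_exists_strictMono {α : Type*} [LinearOrder α] [Finite α] {s : Set α}
    {m : ℕ} : m ≤ s.ncard ↔ ∃ n : Fin m → α, StrictMono n ∧ ∀ i, n i ∈ s := by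
  have := Fintype.ofFinite α
  classical
  constructor
  · intro h
    rw [Set.ncard_eq_toFinset_card'] at h
    exact ⟨_, (s.toFinset.orderEmbOfCardLe h).strictMono,
      fun i => Set.mem_toFinset.1 (s.toFinset.orderEmbOfCardLe_mem h i)⟩
  · rintro ⟨n, hn, hs⟩
    have hcard := Set.ncard_range_of_injective hn.injective
    rw [Nat.card_fin] at hcard
    exact hcard ▸ Set.ncard_le_ncard (Set.range_subset_iff.2 hs)

section ChipFiring

variable {k N : ℕ} {C C' : Config k N}

theorem chipsAt_eq_image (C : Config k N) (v : Vertex k) :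
    chipsAt C v = Subtype.val '' (C ⁻¹' {v}) := by
  ext n
  simp [chipsAt]

theorem ncard_chipsAt (C : Config k N) (v : Vertex k) :
    (chipsAt C v).ncard = (C ⁻¹' {v}).ncard := by
  rw [chipsAt_eq_image, Set.ncard_image_of_injective _ Subtype.val_injective]

theorem le_ncard_chipsAt_iff {v : Vertex k} {m : ℕ} :
    m ≤ (chipsAt C v).ncard ↔ ∃ n : Fin m → Chip N, StrictMono n ∧ ∀ i, C (n i) = v := by
  rw [ncard_chipsAt, le_ncard_iff_exists_strictMono]
  rfl

theorem fire_iff : Fire C C' ↔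
    (∃ n : Fin k → Chip N, StrictMono n ∧ (∀ i, C (n i) = Vertex.center) ∧
      C' = Function.extend n (vert · 1) C) ∨
    ∃ i j a b, a < b ∧ C a = vert i (j + 1) ∧ C b = vert i (j + 1) ∧
      C' = Function.update (Function.update C a (vert i j)) b (vert i (j + 2)) := by
  constructor
  · rintro (⟨n, hn, hC, hmove, hstay⟩ | ⟨i, j, a, b, hab, ha, hb, hmovea, hmoveb, hstay⟩)
    · exact .inl ⟨n, hn, hC, (eq_extend_iff hn.injective).2 ⟨hmove, hstay⟩⟩
    · refine .inr ⟨i, j, a, b, hab, ha, hb, Function.eq_update_iff.2 ⟨hmoveb, fun c hcb => ?_⟩⟩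
      obtain rfl | hca := eq_or_ne c a
      · rw [hmovea, Function.update_self]
      · rw [hstay c hca hcb, Function.update_of_ne hca]
  · rintro (⟨n, hn, hC, h⟩ | ⟨i, j, a, b, hab, ha, hb, rfl⟩)
    · obtain ⟨hmove, hstay⟩ := (eq_extend_iff hn.injective).1 h
      exact .center _ _ n hn hC hmove hstay
    · exact .branch _ _ i j a b hab ha hb (by simp [hab.ne]) (by simp)
        fun c hca hcb => by simp [hca, hcb]

theorem stable_iff_forall_not_fire : Stable C ↔ ∀ C', ¬ Fire C C' := by
  constructor
  · intro h C' hC'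
    obtain ⟨n, hn, hC, -⟩ | ⟨i, j, a, b, hab, ha, hb, -⟩ := fire_iff.1 hC'
    · exact (h .center).not_ge ((deg_center k).le.trans (le_ncard_chipsAt_iff.2 ⟨n, hn, hC⟩))
    · refine (h (vert i (j + 1))).not_ge
        ((deg_branch i j).le.trans (le_ncard_chipsAt_iff.2 ⟨![a, b], ?_, ?_⟩))
      · simpa [Fin.strictMono_iff_lt_succ] using hab
      · simp [Fin.forall_fin_two, ha, hb]
  · intro h v
    by_contra! hv
    cases v with
    | center =>
      rw [deg_center, le_ncard_chipsAt_iff] at hv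
      obtain ⟨n, hn, hC⟩ := hv
      exact h _ (fire_iff.2 (.inl ⟨n, hn, hC, rfl⟩))
    | branch i j =>
      have hdeg : deg (.branch i j) = 2 := deg_branch i j
      rw [hdeg, le_ncard_chipsAt_iff] at hv
      obtain ⟨n, hn, hC⟩ := hv
      exact h _ (fire_iff.2 (.inr ⟨i, j, n 0, n 1, hn (by decide), hC 0, hC 1, rfl⟩))

end ChipFiring

/-- Standard labelings of the poset `P` by `α`: the order-preserving bijections `P ≃ α`. For
`P = Fin k × Fin m` with the product order they are the standard fillings of a `k × m` rectangle. -/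
abbrev StandardLabeling (P α : Type*) [Preorder P] [Preorder α] : Type _ :=
  {e : P ≃ α // StrictMono e}

section Placement

variable {k m N : ℕ}

theorem vert_eq_vert_succ {i i' : Fin k} {j j' : ℕ} :
    vert i j = vert i' (j' + 1) ↔ i = i' ∧ j = j' + 1 := by
  cases j <;> simp [vert]

theorem vert_eq_center {i : Fin k} {j : ℕ} : vert i j = Vertex.center ↔ j = 0 := by
  cases j <;> simp [vert]

/-- The configuration in which the chip `e p` labeling the cell `p` of a rectangle sits on the
branch given by the row of `p`, at the level `ℓ p`. -/
def place (e : Fin k × Fin m ≃ Chip N) (ℓ : Fin k × Fin m → ℕ) : Config k N :=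
  fun c => vert (e.symm c).1 (ℓ (e.symm c))

theorem place_apply (e : Fin k × Fin m ≃ Chip N) (ℓ : Fin k × Fin m → ℕ) (p : Fin k × Fin m) :
    place e ℓ (e p) = vert p.1 (ℓ p) := by
  simp [place]

theorem eq_place_iff {e : Fin k × Fin m ≃ Chip N} {ℓ : Fin k × Fin m → ℕ} {C : Config k N} :
    C = place e ℓ ↔ ∀ p, C (e p) = vert p.1 (ℓ p) := by
  simp only [funext_iff, e.forall_congr_left, place, e.apply_symm_apply]

/-- The configuration in which the branches read off the rows of a filled rectangle, starting at
level `1`. -/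
def rowConfig (e : Fin k × Fin m ≃ Chip N) : Config k N :=
  place e fun p => p.2 + 1

theorem rowConfig_eq_vert_iff {e : Fin k × Fin m ≃ Chip N} {p : Fin k × Fin m} {i : Fin k}
    {j : ℕ} : rowConfig e (e p) = vert i j ↔ p.1 = i ∧ (p.2 : ℕ) + 1 = j := by
  rw [rowConfig, place_apply, eq_comm, vert_eq_vert_succ]
  tauto

theorem chipsAt_rowConfig (e : Fin k × Fin m ≃ Chip N) (i : Fin k) (j : Fin m) :
    chipsAt (rowConfig e) (vert i (j + 1)) = {(e (i, j) : ℕ)} := by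
  have hpre : rowConfig e ⁻¹' {vert i (j + 1)} = {e (i, j)} := by
    ext c
    obtain ⟨p, rfl⟩ := e.surjective c
    simp [rowConfig_eq_vert_iff, Prod.ext_iff, Fin.ext_iff]
  rw [chipsAt_eq_image, hpre, Set.image_singleton]

theorem chipsAt_rowConfig_eq_empty (e : Fin k × Fin m ≃ Chip N) (i : Fin k) {j : ℕ}
    (hj : ¬ (1 ≤ j ∧ j ≤ m)) : chipsAt (rowConfig e) (vert i j) = ∅ := by
  rw [chipsAt_eq_image, Set.image_eq_empty, Set.eq_empty_iff_forall_notMem]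
  intro c hc
  obtain ⟨p, rfl⟩ := e.surjective c
  obtain ⟨-, rfl⟩ := rowConfig_eq_vert_iff.1 hc
  omega

theorem rowConfig_injective :
    Function.Injective (rowConfig : (Fin k × Fin m ≃ Chip N) → Config k N) := by
  intro e e' h
  ext ⟨i, j⟩
  rw [← Set.singleton_eq_singleton_iff, ← chipsAt_rowConfig, h, chipsAt_rowConfig]

theorem stable_rowConfig (hk : 1 ≤ k) (e : Fin k × Fin m ≃ Chip N) : Stable (rowConfig e) := by
  rw [stable_iff_forall_not_fire]
  intro C' hC'
  obtain ⟨n, -, hC, -⟩ | ⟨i, j, a, b, hab, ha, hb, -⟩ := fire_iff.1 hC'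
  · exact absurd (hC ⟨0, hk⟩) (by simp [rowConfig, place, vert_eq_center])
  · obtain ⟨p, rfl⟩ := e.surjective a
    obtain ⟨q, rfl⟩ := e.surjective b
    obtain ⟨hp₁, hp₂⟩ := rowConfig_eq_vert_iff.1 ha
    obtain ⟨hq₁, hq₂⟩ := rowConfig_eq_vert_iff.1 hb
    exact hab.ne (congrArg e (Prod.ext (hp₁.trans hq₁.symm) (Fin.ext (by omega))))

end Placement

section TwoColumns

variable {k N : ℕ}

/-- The configuration obtained from the all-on-center configuration by firing the center with the
chips `s`. -/
noncomputable def onceConfig (s : Fin k → Chip N) : Config k N :=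
  Function.extend s (vert · 1) fun _ => Vertex.center

/-- The configuration in which, after the center has fired twice, the branches in `S` have fired
their first vertex: the two chips of row `i` sit on levels `0` and `2` of branch `i` if `i ∈ S`,
and both on level `1` otherwise. -/
def splitConfig (e : Fin k × Fin 2 ≃ Chip N) (S : Finset (Fin k)) : Config k N :=
  place e fun p => if p.1 ∈ S then 2 * p.2 else 1

theorem onceConfig_eq_vert_succ_iff {s : Fin k → Chip N} (hs : Function.Injective s) {c : Chip N}
    {i : Fin k} {j : ℕ} : onceConfig s c = vert i (j + 1) ↔ c = s i ∧ j = 0 := by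
  by_cases hc : ∃ i', s i' = c
  · obtain ⟨i', rfl⟩ := hc
    rw [onceConfig, hs.extend_apply, vert_eq_vert_succ, hs.eq_iff]
    omega
  · rw [onceConfig, Function.extend_apply' _ _ _ hc]
    exact iff_of_false (by simp [vert]) fun h => hc ⟨i, h.1.symm⟩

theorem onceConfig_eq_center_iff {s : Fin k → Chip N} (hs : Function.Injective s) {c : Chip N} :
    onceConfig s c = Vertex.center ↔ c ∉ Set.range s := by
  by_cases hc : ∃ i', s i' = c
  · obtain ⟨i', rfl⟩ := hc
    simp [onceConfig, hs.extend_apply, vert]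
  · simpa [onceConfig, Function.extend_apply' _ _ _ hc] using hc

theorem fire_start_iff {m : ℕ} {C : Config k (k * m)} :
    Fire (start k m) C ↔ ∃ s, StrictMono s ∧ C = onceConfig s := by
  rw [fire_iff]
  constructor
  · rintro (⟨s, hs, -, rfl⟩ | ⟨_, _, _, _, _, ha, -, -⟩)
    · exact ⟨s, hs, rfl⟩
    · simp [start, vert] at ha
  · rintro ⟨s, hs, rfl⟩
    exact .inl ⟨s, hs, fun _ => rfl, rfl⟩

theorem not_stable_start {m : ℕ} (hm : 1 ≤ m) : ¬ Stable (start k m) := by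
  intro h
  have hcard := h .center
  have hpre : start k m ⁻¹' {.center} = Set.univ := Set.eq_univ_of_forall fun _ => rfl
  rw [ncard_chipsAt, deg_center, hpre] at hcard
  simp only [Set.ncard_univ, Nat.card_eq_fintype_card, Fintype.card_ofFinset, Nat.card_Icc,
    add_tsub_cancel_right] at hcard
  exact hcard.not_ge (Nat.le_mul_of_pos_right k hm)

theorem not_stable_onceConfig {s : Fin k → Chip (k * 2)} (hs : Function.Injective s) :
    ¬ Stable (onceConfig s) := by
  intro h
  have hcard := h .center
  have hpre : onceConfig s ⁻¹' {.center} = (Set.range s)ᶜ :=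
    Set.ext fun _ => onceConfig_eq_center_iff hs
  rw [ncard_chipsAt, deg_center, hpre, Set.ncard_compl,
    Set.ncard_range_of_injective hs] at hcard
  simp only [Nat.card_eq_fintype_card, Fintype.card_ofFinset, Nat.card_Icc,
    add_tsub_cancel_right, Fintype.card_fin] at hcard
  omega

theorem exists_extend_onceConfig_eq_splitConfig {s n : Fin k → Chip (k * 2)}
    (hs : StrictMono s) (hn : StrictMono n) (hsn : ∀ i, n i ∉ Set.range s) :
    ∃ e : StandardLabeling (Fin k × Fin 2) (Chip (k * 2)),
      Function.extend n (vert · 1) (onceConfig s) = splitConfig e.1 ∅ := by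
  let C := Function.extend n (vert · 1) (onceConfig s)
  let f : Fin k × Fin 2 → Chip (k * 2) := fun p => ![min (s p.1) (n p.1), max (s p.1) (n p.1)] p.2
  have hCn (i) : C (n i) = vert i 1 := hn.injective.extend_apply _ _ i
  have hCs (i) : C (s i) = vert i 1 := by
    rw [← (onceConfig_eq_vert_succ_iff hs.injective).2 ⟨rfl, rfl⟩]
    exact Function.extend_apply' _ _ _ fun ⟨i', hi'⟩ => hsn i' ⟨i, hi'.symm⟩
  have hC (p) : C (f p) = vert p.1 1 := by
    obtain ⟨i, j⟩ := p
    have hf : f (i, j) = s i ∨ f (i, j) = n i := by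
      fin_cases j
      · exact min_choice _ _
      · exact max_choice _ _
    rcases hf with h | h <;> simp only [h, hCn, hCs]
  have hrow (i) : StrictMono fun j => f (i, j) := by
    simpa [Fin.strictMono_iff_lt_succ, f] using fun h => hsn i ⟨i, h.symm⟩
  have hcol (j) : StrictMono fun i => f (i, j) := by
    intro i i' hi
    fin_cases j
    · exact min_lt_min (hs hi) (hn hi)
    · exact max_lt_max (hs hi) (hn hi)
  -- The branch on which the chip `f p` sits in `C` tells the row of `p`.
  have hinj : Function.Injective f := by
    rintro ⟨i, j⟩ ⟨i', j'⟩ h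
    obtain rfl : i = i' := (vert_succ_inj ((hC _).symm.trans ((congrArg C h).trans (hC _)))).1
    rw [(hrow i).injective h]
  have hbij : Function.Bijective f :=
    (Fintype.bijective_iff_injective_and_card f).2 ⟨hinj, by simp⟩
  exact ⟨⟨.ofBijective f hbij, strictMono_prod_of_strictMono hcol hrow⟩,
    eq_place_iff.2 fun p => by simpa using hC p⟩

theorem exists_eq_splitConfig_of_fire_onceConfig {s : Fin k → Chip (k * 2)} (hs : StrictMono s)
    {C : Config k (k * 2)} (hC : Fire (onceConfig s) C) :
    ∃ e : StandardLabeling (Fin k × Fin 2) (Chip (k * 2)), C = splitConfig e.1 ∅ := by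
  obtain ⟨n, hn, hcenter, rfl⟩ | ⟨i, j, a, b, hab, ha, hb, -⟩ := fire_iff.1 hC
  · exact exists_extend_onceConfig_eq_splitConfig hs hn
      fun i => (onceConfig_eq_center_iff hs.injective).1 (hcenter i)
  · rw [onceConfig_eq_vert_succ_iff hs.injective] at ha hb
    exact absurd (ha.1.trans hb.1.symm) hab.ne

theorem fire_onceConfig_splitConfig (e : StandardLabeling (Fin k × Fin 2) (Chip N)) :
    Fire (onceConfig fun i => e.1 (i, 0)) (splitConfig e.1 ∅) := by
  have hcol := strictMono_column e.2
  refine fire_iff.2 (.inl ⟨fun i => e.1 (i, 1), hcol 1, fun i => ?_, ?_⟩)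
  · simp [onceConfig_eq_center_iff (hcol 0).injective]
  · rw [eq_comm, splitConfig, eq_place_iff]
    rintro ⟨i, j⟩
    fin_cases j
    · refine (Function.extend_apply' _ _ _ (by simp)).trans ?_
      simp [onceConfig_eq_vert_succ_iff (hcol 0).injective (j := 0)]
    · simpa using (hcol 1).injective.extend_apply _ _ i

theorem update_splitConfig (e : Fin k × Fin 2 ≃ Chip N) {S : Finset (Fin k)} (i : Fin k) :
    Function.update (Function.update (splitConfig e S) (e (i, 0)) (vert i 0))
      (e (i, 1)) (vert i 2) = splitConfig e (insert i S) := by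
  refine eq_place_iff.2 fun ⟨i', j⟩ => ?_
  obtain rfl | hi := eq_or_ne i' i
  · fin_cases j <;> simp
  · simp [hi, splitConfig, place_apply]

theorem extend_splitConfig_univ (e : Fin k × Fin 2 ≃ Chip N) :
    Function.extend (fun i => e (i, 0)) (vert · 1) (splitConfig e Finset.univ) = rowConfig e := by
  refine eq_place_iff.2 fun ⟨i, j⟩ => ?_
  fin_cases j
  · exact (e.injective.comp (Prod.mk_left_injective 0)).extend_apply _ _ i
  · exact (Function.extend_apply' _ _ _ (by simp)).trans (by simp [splitConfig, place_apply])

theorem eq_of_splitConfig_eq_center {e : Fin k × Fin 2 ≃ Chip N} (he : StrictMono e)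
    {S : Finset (Fin k)} {n : Fin k → Chip N} (hn : StrictMono n)
    (hC : ∀ i, splitConfig e S (n i) = Vertex.center) :
    (n = fun i => e (i, 0)) ∧ S = Finset.univ := by
  obtain rfl : n = fun i => e (i, 0) := by
    refine eq_of_strictMono_of_range_subset hn (strictMono_column he 0) ?_
    rintro _ ⟨i, rfl⟩
    obtain ⟨⟨i', j⟩, h⟩ := e.surjective (n i)
    have hlevel := hC i
    rw [← h, splitConfig, place_apply, vert_eq_center] at hlevel
    obtain rfl : j = 0 := by
      split_ifs at hlevel
      dsimp only at hlevel
      omega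
    exact ⟨i', h⟩
  refine ⟨rfl, Finset.eq_univ_of_forall fun i => ?_⟩
  simpa [splitConfig, place_apply, vert_eq_center] using hC i

theorem eq_of_splitConfig_eq_vert_succ {e : Fin k × Fin 2 ≃ Chip N} (he : StrictMono e)
    {S : Finset (Fin k)} {i : Fin k} {j : ℕ} {a b : Chip N} (hab : a < b)
    (ha : splitConfig e S a = vert i (j + 1)) (hb : splitConfig e S b = vert i (j + 1)) :
    i ∉ S ∧ j = 0 ∧ a = e (i, 0) ∧ b = e (i, 1) := by
  obtain ⟨⟨i₁, j₁⟩, rfl⟩ := e.surjective a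
  obtain ⟨⟨i₂, j₂⟩, rfl⟩ := e.surjective b
  obtain ⟨rfl, hja⟩ := vert_eq_vert_succ.1 ((place_apply e _ _).symm.trans ha)
  obtain ⟨rfl, hjb⟩ := vert_eq_vert_succ.1 ((place_apply e _ _).symm.trans hb)
  dsimp only at hja hjb hab ⊢
  have hj : j₁ < j₂ := (strictMono_row he i₂).lt_iff_lt.1 hab
  obtain ⟨rfl, rfl⟩ : j₁ = 0 ∧ j₂ = 1 := by omega
  have hi : i₂ ∉ S := fun hi => by simp [hi] at hja
  exact ⟨hi, by simpa [hi] using hja, rfl, rfl⟩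

theorem fire_splitConfig_iff (e : StandardLabeling (Fin k × Fin 2) (Chip N)) {S : Finset (Fin k)}
    {C : Config k N} : Fire (splitConfig e.1 S) C ↔
      (S = Finset.univ ∧ C = rowConfig e.1) ∨ ∃ i ∉ S, C = splitConfig e.1 (insert i S) := by
  obtain ⟨e, he⟩ := e
  rw [fire_iff]
  constructor
  · rintro (⟨n, hn, hC, rfl⟩ | ⟨i, j, a, b, hab, ha, hb, rfl⟩)
    · obtain ⟨rfl, rfl⟩ := eq_of_splitConfig_eq_center he hn hC
      exact .inl ⟨rfl, extend_splitConfig_univ e⟩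
    · obtain ⟨hi, rfl, rfl, rfl⟩ := eq_of_splitConfig_eq_vert_succ he hab ha hb
      exact .inr ⟨i, hi, update_splitConfig e i⟩
  · rintro (⟨rfl, rfl⟩ | ⟨i, hi, rfl⟩)
    · exact .inl ⟨_, strictMono_column he 0, by simp [splitConfig, place_apply, vert],
        (extend_splitConfig_univ e).symm⟩
    · refine .inr ⟨i, 0, e (i, 0), e (i, 1), he ?_, ?_, ?_, (update_splitConfig e i).symm⟩
      · simp [Prod.mk_lt_mk]
      · simp [splitConfig, place_apply, hi]
      · simp [splitConfig, place_apply, hi]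

theorem not_stable_splitConfig (e : StandardLabeling (Fin k × Fin 2) (Chip N))
    (S : Finset (Fin k)) : ¬ Stable (splitConfig e.1 S) := by
  rw [stable_iff_forall_not_fire]
  intro h
  have hS : S = Finset.univ := by
    refine Finset.eq_univ_of_forall fun i => ?_
    by_contra hi
    exact h _ ((fire_splitConfig_iff e).2 (.inr ⟨i, hi, rfl⟩))
  exact h _ ((fire_splitConfig_iff e).2 (.inl ⟨hS, rfl⟩))

theorem eq_of_reachable_start (hk : 1 ≤ k) {C : Config k (k * 2)}
    (h : Reachable (start k 2) C) :
    C = start k 2 ∨ (∃ s, StrictMono s ∧ C = onceConfig s) ∨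
      ∃ e : StandardLabeling (Fin k × Fin 2) (Chip (k * 2)),
        (∃ S, C = splitConfig e.1 S) ∨ C = rowConfig e.1 := by
  induction h with
  | refl => exact .inl rfl
  | tail _ hfire ih =>
    obtain rfl | ⟨s, hs, rfl⟩ | ⟨e, ⟨S, rfl⟩ | rfl⟩ := ih
    · exact .inr (.inl (fire_start_iff.1 hfire))
    · obtain ⟨e, rfl⟩ := exists_eq_splitConfig_of_fire_onceConfig hs hfire
      exact .inr (.inr ⟨e, .inl ⟨∅, rfl⟩⟩)
    · obtain ⟨-, rfl⟩ | ⟨i, -, rfl⟩ := (fire_splitConfig_iff e).1 hfire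
      · exact .inr (.inr ⟨e, .inr rfl⟩)
      · exact .inr (.inr ⟨e, .inl ⟨_, rfl⟩⟩)
    · exact absurd hfire (stable_iff_forall_not_fire.1 (stable_rowConfig hk e.1) _)

theorem reachable_splitConfig (e : StandardLabeling (Fin k × Fin 2) (Chip (k * 2)))
    (S : Finset (Fin k)) : Reachable (start k 2) (splitConfig e.1 S) := by
  induction S using Finset.induction_on with
  | empty =>
    exact .tail (.single (fire_start_iff.2 ⟨_, strictMono_column e.2 0, rfl⟩))
      (fire_onceConfig_splitConfig e)
  | insert i S hi ih => exact ih.tail ((fire_splitConfig_iff e).2 (.inr ⟨i, hi, rfl⟩))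

theorem stableConfigs_two_eq_range (hk : 1 ≤ k) : stableConfigs k 2 =
    Set.range fun e : StandardLabeling (Fin k × Fin 2) (Chip (k * 2)) => rowConfig e.1 := by
  ext C
  constructor
  · rintro ⟨hreach, hstable⟩
    obtain rfl | ⟨s, hs, rfl⟩ | ⟨e, ⟨S, rfl⟩ | rfl⟩ := eq_of_reachable_start hk hreach
    · exact absurd hstable (not_stable_start one_le_two)
    · exact absurd hstable (not_stable_onceConfig hs.injective)
    · exact absurd hstable (not_stable_splitConfig e S)
    · exact ⟨e, rfl⟩
  · rintro ⟨e, rfl⟩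
    exact ⟨(reachable_splitConfig e Finset.univ).tail
      ((fire_splitConfig_iff e).2 (.inl ⟨rfl, rfl⟩)), stable_rowConfig hk e.1⟩

/-- The stable configurations correspond to the standard labelings that their branches read off. -/
noncomputable def standardLabelingEquivStableConfigs (hk : 1 ≤ k) :
    StandardLabeling (Fin k × Fin 2) (Chip (k * 2)) ≃ stableConfigs k 2 :=
  (Equiv.ofInjective _ (rowConfig_injective.comp Subtype.val_injective)).trans
    (Equiv.setCongr (stableConfigs_two_eq_range hk).symm)

theorem coe_standardLabelingEquivStableConfigs (hk : 1 ≤ k)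
    (e : StandardLabeling (Fin k × Fin 2) (Chip (k * 2))) :
    (standardLabelingEquivStableConfigs hk e : Config k (k * 2)) = rowConfig e.1 :=
  rfl

end TwoColumns

section Tableaux

variable {k m : ℕ}

theorem card_rect (k m : ℕ) : (rect k m).card = k * m := by
  have hcells : (rect k m).cells = Finset.range k ×ˢ Finset.range m := by
    ext ⟨i, j⟩
    simp [YoungDiagram.mem_cells, mem_rect]
  rw [YoungDiagram.card, hcells, Finset.card_product, Finset.card_range, Finset.card_range]

theorem coe_cells_rect (k m : ℕ) : ((rect k m).cells : Set (ℕ × ℕ)) =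
    Set.range (Prod.map (↑) (↑) : Fin k × Fin m → ℕ × ℕ) := by
  ext ⟨i, j⟩
  simp [mem_rect]

namespace StandardLabeling

/-- The entry in row `i` and column `j` of a standardly labeled rectangle, with the value `0`
outside the rectangle. -/
def entry (e : StandardLabeling (Fin k × Fin m) (Chip (k * m))) (i j : ℕ) : ℕ :=
  if h : i < k ∧ j < m then e.1 (⟨i, h.1⟩, ⟨j, h.2⟩) else 0

theorem entry_coe (e : StandardLabeling (Fin k × Fin m) (Chip (k * m))) (p : Fin k × Fin m) :
    entry e p.1 p.2 = e.1 p := by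
  simp [entry]

theorem bijOn_entry (e : StandardLabeling (Fin k × Fin m) (Chip (k * m))) :
    Set.BijOn (fun c : ℕ × ℕ => entry e c.1 c.2) ((rect k m).cells : Set (ℕ × ℕ))
      (Set.Icc 1 (rect k m).card) := by
  rw [coe_cells_rect, card_rect]
  refine ⟨?_, ?_, ?_⟩
  · rintro _ ⟨p, rfl⟩
    exact Set.mem_of_eq_of_mem (entry_coe e p) (e.1 p).2
  · rintro _ ⟨p, rfl⟩ _ ⟨q, rfl⟩ h
    have hpq : (e.1 p : ℕ) = e.1 q := by rw [← entry_coe, ← entry_coe]; exact h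
    rw [e.1.injective (Subtype.ext hpq)]
  · intro c hc
    exact ⟨_, ⟨e.1.symm ⟨c, hc⟩, rfl⟩,
      (entry_coe e _).trans (congrArg Subtype.val (e.1.apply_symm_apply ⟨c, hc⟩))⟩

/-- The standard Young tableau given by a standard labeling of a rectangle. -/
def toTableau (e : StandardLabeling (Fin k × Fin m) (Chip (k * m))) :
    StandardYoungTableau (rect k m) where
  entry := entry e
  bijOn := bijOn_entry e
  row_strict {i j₁ j₂} hj hmem := by
    obtain ⟨hi, hj₂⟩ := mem_rect.1 hmem
    have hlt : ((⟨i, hi⟩, ⟨j₁, hj.trans hj₂⟩) : Fin k × Fin m) < (⟨i, hi⟩, ⟨j₂, hj₂⟩) :=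
      Prod.mk_lt_mk_iff_right.2 hj
    simpa only [← entry_coe] using Subtype.coe_lt_coe.2 (e.2 hlt)
  col_strict {i₁ i₂ j} hi hmem := by
    obtain ⟨hi₂, hj⟩ := mem_rect.1 hmem
    have hlt : ((⟨i₁, hi.trans hi₂⟩, ⟨j, hj⟩) : Fin k × Fin m) < (⟨i₂, hi₂⟩, ⟨j, hj⟩) :=
      Prod.mk_lt_mk_iff_left.2 hi
    simpa only [← entry_coe] using Subtype.coe_lt_coe.2 (e.2 hlt)
  zeros h := dif_neg (mem_rect.not.1 h)

theorem toTableau_injective : Function.Injective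
    (toTableau : StandardLabeling (Fin k × Fin m) (Chip (k * m)) → _) := by
  intro e e' h
  ext p
  rw [← entry_coe, ← entry_coe]
  exact congrArg (fun Y : StandardYoungTableau _ => Y.entry p.1 p.2) h

theorem toTableau_surjective : Function.Surjective
    (toTableau : StandardLabeling (Fin k × Fin m) (Chip (k * m)) → _) := by
  intro Y
  have hcells (p : Fin k × Fin m) : ((p.1 : ℕ), (p.2 : ℕ)) ∈ rect k m :=
    mem_rect.2 ⟨p.1.2, p.2.2⟩
  let f (p : Fin k × Fin m) : Chip (k * m) :=
    ⟨Y.entry p.1 p.2, card_rect k m ▸ Y.bijOn.mapsTo (hcells p)⟩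
  have hinj : Function.Injective f := by
    intro p q h
    have hpq := Y.bijOn.injOn (hcells p) (hcells q) (congrArg Subtype.val h)
    simpa [Prod.ext_iff, Fin.ext_iff] using hpq
  have hbij : Function.Bijective f :=
    (Fintype.bijective_iff_injective_and_card f).2 ⟨hinj, by simp⟩
  have hmono : StrictMono f := strictMono_prod_of_strictMono
    (fun j _ i hi => Y.col_strict hi (hcells (i, j)))
    (fun i _ j hj => Y.row_strict hj (hcells (i, j)))
  refine ⟨⟨.ofBijective f hbij, hmono⟩, ?_⟩
  ext i j
  by_cases h : i < k ∧ j < m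
  · exact dif_pos h
  · exact (dif_neg h).trans (Y.zeros (mem_rect.not.2 h)).symm

/-- Standard labelings of a rectangle are the same as standard Young tableaux. -/
noncomputable def equivTableau :
    StandardLabeling (Fin k × Fin m) (Chip (k * m)) ≃ StandardYoungTableau (rect k m) :=
  .ofBijective toTableau ⟨toTableau_injective, toTableau_surjective⟩

theorem equivTableau_entry (e : StandardLabeling (Fin k × Fin m) (Chip (k * m))) (i : Fin k)
    (j : Fin m) : (equivTableau e).entry i j = e.1 (i, j) :=
  entry_coe e (i, j)

end StandardLabeling

end Tableaux

section Counting

open Finset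

theorem forall_le_iff_card_lt_le {k : ℕ} {α : Type*} [LinearOrder α] {f g : Fin k → α}
    (hf : Monotone f) (hg : Monotone g) :
    (∀ i, f i ≤ g i) ↔ ∀ c, #{i | g i < c} ≤ #{i | f i < c} := by
  constructor
  · intro h c
    exact card_le_card fun i => by simpa using (h i).trans_lt
  · intro h i
    by_contra! hi
    have hg' : Iic i ⊆ ({j | g j < f i} : Finset (Fin k)) := fun j hj => by
      simpa using (hg (mem_Iic.1 hj)).trans_lt hi
    have hf' : ({j | f j < f i} : Finset (Fin k)) ⊆ Iio i := fun j hj => by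
      simpa using hf.reflect_lt (mem_filter.1 hj).2
    have hcard := (card_le_card hg').trans ((h (f i)).trans (card_le_card hf'))
    rw [Fin.card_Iic, Fin.card_Iio] at hcard
    omega

theorem count_take_ofFn {α : Type*} [DecidableEq α] {N : ℕ} (f : Fin N → α) (n : ℕ) (x : α) :
    ((List.ofFn f).take n).count x = #{a : Fin N | (a : ℕ) < n ∧ f a = x} := by
  induction N generalizing n with
  | zero => simp
  | succ N ih =>
    cases n with
    | zero => simp
    | succ n =>
      rw [List.ofFn_succ, List.take_succ_cons, List.count_cons, ih, Fin.card_filter_univ_succ]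
      by_cases h : f 0 = x <;> simp [h]

section Columns

variable {k : ℕ} {ι α : Type*} [LinearOrder α]

theorem eq_of_strictMono_column {e e' : Fin k × ι ≃ α}
    (he : ∀ x, StrictMono fun i => e (i, x)) (he' : ∀ x, StrictMono fun i => e' (i, x))
    (h : ∀ a, (e.symm a).2 = (e'.symm a).2) : e = e' := by
  ext ⟨i, x⟩
  refine congrFun (eq_of_strictMono_of_range_subset (he x) (he' x) ?_) i
  rintro _ ⟨i, rfl⟩
  obtain ⟨⟨i', x'⟩, hp⟩ := e'.surjective (e (i, x))
  have hx := h (e (i, x))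
  rw [e.symm_apply_apply, ← hp, e'.symm_apply_apply] at hx
  obtain rfl : x = x' := hx
  exact ⟨i', hp⟩

theorem exists_strictMono_column [Fintype α] [DecidableEq ι] {w : α → ι}
    (hw : ∀ x, #{a | w a = x} = k) :
    ∃ e : Fin k × ι ≃ α, (∀ x, StrictMono fun i => e (i, x)) ∧ ∀ a, (e.symm a).2 = w a := by
  have hcard (x : ι) : Fintype.card {a // w a = x} = k := by rw [Fintype.card_subtype, hw]
  let o (x : ι) : Fin k ≃o {a // w a = x} := Fintype.orderIsoFinOfCardEq _ (hcard x)
  let e : Fin k × ι ≃ α := (Equiv.prodComm _ _).trans <| (Equiv.sigmaEquivProd _ _).symm.trans <|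
    (Equiv.sigmaCongrRight fun x => (o x).toEquiv).trans (Equiv.sigmaFiberEquiv w)
  exact ⟨e, fun x _ _ h => (o x).strictMono h, fun a => rfl⟩

end Columns

/-- The first column of a tableau is read as up steps, the second as down steps. -/
def columnStep : Fin 2 ≃ DyckStep where
  toFun := ![.U, .D]
  invFun
    | .U => 0
    | .D => 1
  left_inv := by decide
  right_inv := by rintro (_ | _) <;> rfl

variable {k : ℕ}

/-- The word recording the column of `n` in the filling `e`, for `n = 0, 1, …`. -/
def stepWord (e : Fin k × Fin 2 ≃ Fin (k * 2)) : List DyckStep :=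
  List.ofFn fun n => columnStep (e.symm n).2

theorem count_take_stepWord (e : Fin k × Fin 2 ≃ Fin (k * 2)) (n : ℕ) (j : Fin 2) :
    ((stepWord e).take n).count (columnStep j) = #{i | (e (i, j) : ℕ) < n} := by
  rw [stepWord, count_take_ofFn]
  have himage : ({a | a < n ∧ columnStep (e.symm a).2 = columnStep j} : Finset (Fin (k * 2))) =
      image (fun i => e (i, j)) {i | (e (i, j) : ℕ) < n} := by
    ext a
    obtain ⟨⟨i, j'⟩, rfl⟩ := e.surjective a
    simp only [mem_filter_univ, mem_image, e.symm_apply_apply, columnStep.injective.eq_iff,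
      e.injective.eq_iff, Prod.mk.injEq]
    aesop
  rw [himage, card_image_of_injective _ fun _ _ h => congrArg Prod.fst (e.injective h)]

theorem count_stepWord (e : Fin k × Fin 2 ≃ Fin (k * 2)) (j : Fin 2) :
    (stepWord e).count (columnStep j) = k := by
  have h := count_take_stepWord e (k * 2) j
  rw [List.take_of_length_le (by simp [stepWord])] at h
  simpa using h

theorem strictMono_iff_count_take_stepWord {e : Fin k × Fin 2 ≃ Fin (k * 2)}
    (he : ∀ j, StrictMono fun i => e (i, j)) :
    StrictMono e ↔ ∀ n, ((stepWord e).take n).count .D ≤ ((stepWord e).take n).count .U := by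
  have hle : StrictMono e ↔ ∀ i, (e (i, 0) : ℕ) ≤ e (i, 1) := by
    refine ⟨fun h i => (strictMono_row h i zero_lt_one).le, fun h => ?_⟩
    refine strictMono_prod_of_strictMono he fun i => Fin.strictMono_iff_lt_succ.2 fun j => ?_
    obtain rfl : j = 0 := Subsingleton.elim _ _
    exact (h i).lt_of_ne (by simp [Fin.val_inj])
  have hmono (j : Fin 2) : Monotone fun i => (e (i, j) : ℕ) := fun _ _ h => (he j).monotone h
  rw [hle, forall_le_iff_card_lt_le (hmono 0) (hmono 1)]
  simp only [← count_take_stepWord]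
  rfl

/-- The Dyck word of a standardly labeled two-column rectangle. -/
def dyckWord (e : StandardLabeling (Fin k × Fin 2) (Fin (k * 2))) : DyckWord where
  toList := stepWord e.1
  count_U_eq_count_D := (count_stepWord e.1 0).trans (count_stepWord e.1 1).symm
  count_D_le_count_U := (strictMono_iff_count_take_stepWord (strictMono_column e.2)).1 e.2

theorem semilength_dyckWord (e : StandardLabeling (Fin k × Fin 2) (Fin (k * 2))) :
    (dyckWord e).semilength = k :=
  count_stepWord e.1 0

theorem dyckWord_injective :
    Function.Injective (dyckWord : StandardLabeling (Fin k × Fin 2) (Fin (k * 2)) → DyckWord) := by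
  intro e e' h
  have hword := List.ofFn_injective (congrArg DyckWord.toList h)
  exact Subtype.ext <| eq_of_strictMono_column (strictMono_column e.2) (strictMono_column e'.2)
    fun a => columnStep.injective (congrFun hword a)

theorem exists_dyckWord_eq {p : DyckWord} (hp : p.semilength = k) :
    ∃ e : StandardLabeling (Fin k × Fin 2) (Fin (k * 2)), dyckWord e = p := by
  obtain ⟨w, hw⟩ : ∃ w : Fin (k * 2) → Fin 2, List.ofFn (fun a => columnStep (w a)) = p.toList := by
    have hlen : p.toList.length = k * 2 := by rw [← p.two_mul_semilength_eq_length, hp, mul_comm]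
    refine ⟨fun a => columnStep.symm (p.toList.get (a.cast hlen.symm)), ?_⟩
    exact List.ext_getElem (by simp [hlen]) (by simp)
  have hcard (j : Fin 2) : #{a | w a = j} = k := by
    have hcount : p.toList.count (columnStep j) = k := by
      fin_cases j
      · exact hp
      · exact p.semilength_eq_count_D.symm.trans hp
    rw [← hw, ← List.take_length (l := List.ofFn _), count_take_ofFn] at hcount
    simpa [columnStep.injective.eq_iff] using hcount
  obtain ⟨e, hcol, he⟩ := exists_strictMono_column hcard
  have hword : stepWord e = p.toList := by simp only [stepWord, he, hw]
  refine ⟨⟨e, (strictMono_iff_count_take_stepWord hcol).2 ?_⟩, DyckWord.ext hword⟩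
  rw [hword]
  exact p.count_D_le_count_U

theorem card_standardLabeling_fin (k : ℕ) :
    Nat.card (StandardLabeling (Fin k × Fin 2) (Fin (k * 2))) = catalan k := by
  have hbij : Function.Bijective fun e : StandardLabeling (Fin k × Fin 2) (Fin (k * 2)) =>
      (⟨dyckWord e, semilength_dyckWord e⟩ : {p : DyckWord // p.semilength = k}) :=
    ⟨fun _ _ h => dyckWord_injective (congrArg Subtype.val h), fun ⟨p, hp⟩ =>
      (exists_dyckWord_eq hp).imp fun _ he => Subtype.ext he⟩
  rw [Nat.card_eq_of_bijective _ hbij, Nat.card_eq_fintype_card,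
    DyckWord.card_dyckWord_semilength_eq_catalan]

/-- Relabeling along an order isomorphism preserves standard labelings. -/
def StandardLabeling.congr {P α β : Type*} [Preorder P] [Preorder α] [Preorder β] (o : α ≃o β) :
    StandardLabeling P α ≃ StandardLabeling P β :=
  (Equiv.equivCongr (.refl P) o.toEquiv).subtypeEquiv
    fun _ => ⟨o.strictMono.comp, fun h _ _ hab => o.lt_iff_lt.1 (h hab)⟩

theorem card_standardLabeling_chip (k : ℕ) :
    Nat.card (StandardLabeling (Fin k × Fin 2) (Chip (k * 2))) = catalan k := by
  have hcard : Fintype.card (Chip (k * 2)) = k * 2 := by simp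
  rw [← Nat.card_congr (StandardLabeling.congr (Fintype.orderIsoFinOfCardEq _ hcard)),
    card_standardLabeling_fin]

end Counting

end StarChip

theorem theorem5p1 (k : ℕ) (hk : 1 ≤ k) :
    (∃ φ : StarChip.stableConfigs k 2 ≃ StarChip.StandardYoungTableau (StarChip.rect k 2),
      (∀ (C : StarChip.stableConfigs k 2) (i : Fin k) (j : Fin 2),
        StarChip.chipsAt C.1 (StarChip.vert i (j + 1)) = {(φ C).entry i j}) ∧
      (∀ (Y : StarChip.StandardYoungTableau (StarChip.rect k 2)) (i : Fin k) (j : ℕ),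
        StarChip.chipsAt (φ.symm Y).1 (StarChip.vert i j) =
          if 1 ≤ j ∧ j ≤ 2 then {Y.entry i (j - 1)} else ∅)) ∧
    Nat.card (StarChip.StandardYoungTableau (StarChip.rect k 2)) = catalan k ∧
    Nat.card (StarChip.stableConfigs k 2) = catalan k := by
  open StarChip StandardLabeling in
  let ψ := standardLabelingEquivStableConfigs hk
  have hcells (e) (i : Fin k) (j : Fin 2) :
      chipsAt (ψ e).1 (vert i (j + 1)) = {(equivTableau e).entry i j} := by
    rw [coe_standardLabelingEquivStableConfigs, chipsAt_rowConfig, equivTableau_entry]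
  refine ⟨⟨ψ.symm.trans equivTableau, fun C i j => ?_, fun Y i j => ?_⟩, ?_, ?_⟩
  · simpa using hcells (ψ.symm C) i j
  · split_ifs with hj
    · obtain ⟨j, rfl⟩ := Nat.exists_eq_add_of_le' hj.1
      simpa using hcells (equivTableau.symm Y) i ⟨j, by omega⟩
    · exact chipsAt_rowConfig_eq_empty _ i hj
  · rw [← Nat.card_congr equivTableau, card_standardLabeling_chip]
  · rw [← Nat.card_congr ψ, card_standardLabeling_chip]
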